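/- Fix an integer $n\ge 0$ and unknowns $\Xi=\{x_1,\dots,x_n\}$. A word equation in $n$ unknowns is a pair $E=(u,v)$ of words over $\Xi$; put $|E|=|u|+|v|$ and $|E|_{x}=|u|_{x}+|v|_{x}$, where $|w|$ is the length of a word $w$ and $|w|_{x}$ is the number of occurrences of the letter $x$ in $w$. A solution of $E$ is a monoid morphism $h:\Xi^*\to\{a_1,\dots,a_k\}^*$ into a free monoid over a finite alphabet (of any size $k$) with $h(u)=h(v)$. For a morphism $h$ let $\Gamma_h\subseteq\mathbb Q^n$ be the rational subspace spanned by the vectors $(|h(x_1)|_{a_i},\dots,|h(x_n)|_{a_i})$, $i=1,\dots,k$; the rank of $h$ is $\dim\Gamma_h$, and two morphisms $h,h'$ are linearly equivalent if $\Gamma_h=\Gamma_{h'}$. Two equations $E,E'$ are strongly independent if each proper subsystem of the system consisting of $E$ and $E'$ has a solution $\Xi^*\to\{a_1,\dots,a_k\}^*$ of rank $n-1$ that is not a solution of the whole system (so each of $E$, $E'$ has a solution of rank $n-1$ that does not solve the other). Theorem. Let $E,E'$ be strongly independent word equations in $n$ unknowns, and let $m$ be the number of their pairwise linearly nonequivalent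 common solutions of rank $n-1$, that is, the number of linear equivalence classes containing a common solution of $E$ and $E'$ of rank $n-1$. Then $m$ is finite and (1) $m\le |E|+|E'|$; (2) there are indices $1\le k<\ell\le n$ such that $m\le 2\left(|E|_{x_k}+|E|_{x_\ell}\right)$. -/

import Mathlib

noncomputable section

namespace WordEq

/-- A word equation `(u, v)` in the `n` unknowns `x_0, …, x_{n-1}`. -/
abbrev Equation (n : ℕ) : Type := FreeMonoid (Fin n) × FreeMonoid (Fin n)

/-- The length `|E| = |u| + |v|` of an equation `E = (u, v)`. -/
def Equation.length {n : ℕ} (E : Equation n) : ℕ := E.1.length + E.2.length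

/-- The number `|E|_{x_j} = |u|_{x_j} + |v|_{x_j}` of occurrences of the unknown `x_j` in `E`. -/
def Equation.occ {n : ℕ} (E : Equation n) (j : Fin n) : ℕ :=
  E.1.toList.count j + E.2.toList.count j

/-- A morphism from the free monoid on the `n` unknowns to the free monoid on a finite alphabet
`{a_0, …, a_{k-1}}` of arbitrary size `k`. -/
structure Morphism (n : ℕ) where
  /-- the number of letters of the target alphabet -/
  k : ℕ
  /-- the morphism itself -/
  toHom : FreeMonoid (Fin n) →* FreeMonoid (Fin k)

namespace Morphism

variable {n : ℕ}

/-- `h` is a solution of the equation `E = (u, v)`: `h(u) = h(v)`. -/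
def Solves (h : Morphism n) (E : Equation n) : Prop := h.toHom E.1 = h.toHom E.2

/-- The vector `γ(h)_i = (|h(x_0)|_{a_i}, …, |h(x_{n-1})|_{a_i})`. -/
def gamma (h : Morphism n) (i : Fin h.k) : Fin n → ℚ :=
  fun j => ((h.toHom (FreeMonoid.of j)).toList.count i : ℚ)

/-- The subspace `Γ_h` of `ℚⁿ` spanned by the vectors `γ(h)_i`. -/
def Gamma (h : Morphism n) : Submodule ℚ (Fin n → ℚ) := Submodule.span ℚ (Set.range h.gamma)

/-- The rank of `h`, that is, the dimension of `Γ_h`. -/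
def rank (h : Morphism n) : ℕ := Module.finrank ℚ h.Gamma

/-- Linear equivalence of morphisms, as an equivalence relation: `Γ_h = Γ_{h'}`. -/
def linEquiv (n : ℕ) : Setoid (Morphism n) where
  r h h' := h.Gamma = h'.Gamma
  iseqv := ⟨fun _ => rfl, fun e => e.symm, fun e e' => e.trans e'⟩

end Morphism

/-- A system `(T i)` of equations in `n` unknowns is strongly independent if every proper subsystem
has a solution of rank `n - 1` which is not a solution of the whole system. The rank condition is
written `rank + 1 = n`, to avoid truncated subtraction. -/
def StronglyIndependent {n : ℕ} {ι : Type*} (T : ι → Equation n) : Prop :=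
  ∀ J : Set ι, J ≠ Set.univ →
    ∃ h : Morphism n, h.rank + 1 = n ∧ (∀ i ∈ J, h.Solves (T i)) ∧ ¬ ∀ i, h.Solves (T i)

/-- The common solutions of rank `n - 1` of two equations in `n` unknowns. -/
def commonSolutions {n : ℕ} (E E' : Equation n) : Set (Morphism n) :=
  {h | h.Solves E ∧ h.Solves E' ∧ h.rank + 1 = n}

/-- The number (possibly infinite a priori) of pairwise linearly nonequivalent common solutions of
rank `n - 1` of `E` and `E'`: the number of linear equivalence classes that contain one. -/
def numSolutions {n : ℕ} (E E' : Equation n) : ℕ∞ :=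
  (Quotient.mk (Morphism.linEquiv n) '' commonSolutions E E').encard

end WordEq

end

/-!
The proof encodes words by polynomials and counts monomials.

To an equation `E = (u, v)` belongs the row `foxDiff E` of the differences of the Fox derivatives of
`u` and `v`, taken with commuting variables. Let `h` be a morphism. By the chain rule `fox_flatMap`,
`h` solves `E` if and only if the image of this row under the substitution
`x_j ↦` (commutative image of `h(x_j)`) is orthogonal to the vectors of Fox derivatives of the words
`h(x_j)`. At the point `(1, …, 1)` these vectors become the generators of `Γ_h`, so if `h` has rank
`n - 1`, they leave room for one row up to proportionality. Hence a common solution of `E` and `E'`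
of rank `n - 1` makes all `2 × 2` minors `foxMinor E E' k l` vanish after the substitution
(`subst_foxMinor_eq_zero`), while strong independence provides `k < l` with a nonzero minor `D`
(`exists_foxMinor_ne_zero`). The substitution identifies two monomials exactly if their exponents
differ by a vector orthogonal to `Γ_h`, so every monomial of `D` is identified with another one.

Suppose first that no unknown is erased by `h`. Then the hyperplane `Γ_h` meets the open positive
orthant, and two positive weights on different sides of `Γ_h` have different monomials of minimal
weight in `D`. If there are `m` such hyperplanes, then they cut the orthant into at least `m + 1`
cells (`exists_separated_points`), so that `D` has `m + 1` monomials of minimal weight, and these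
are pairwise incomparable (`exists_antichain_support`). On the other hand, the monomials of a Fox
derivative come from prefixes of a word and so form a chain; therefore the monomials of `D` are
covered by `2 (|E|_{x_k} + |E|_{x_l})` chains (`card_le_of_antichain`), and `m + 1` is at most this
number.

The remaining common solutions erase exactly one unknown, and all of them the same one
(`erasingHyperplanes_subsingleton`), for otherwise both equations would become trivial on the
deletion of either of two unknowns, and `D` would vanish. They contribute at most one class, which
gives the second bound. As `D` is antisymmetric in `E` and `E'`, the bound also holds with `E'` in
place of `E`, and the smaller of the two is at most `|E| + |E'|`.
-/

/-! ### Fox derivatives with commuting variables -/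

namespace WordEq

open MvPolynomial

section Fox

variable {α β : Type*}

/-- The commutative image of a word: the product of its letters as a monomial. -/
noncomputable def mon (w : List α) : MvPolynomial α ℤ := (w.map X).prod

/-- The Fox derivative of the word `w` with respect to the letter `j`, with commuting variables: the
sum, over all factorizations `w = p j s`, of the commutative image of the prefix `p`. -/
noncomputable def fox [DecidableEq α] (j : α) : List α → MvPolynomial α ℤ
  | [] => 0
  | x :: w => (if x = j then 1 else 0) + X x * fox j w

/-- The exponents of the monomials that make up `fox j w`, in the order of the occurrences of `j`:
the Parikh vectors of the prefixes of `w` that are followed by `j`. -/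
noncomputable def foxExponents [DecidableEq α] (j : α) : List α → List (α →₀ ℕ)
  | [] => []
  | x :: w => (if x = j then [0] else []) ++
      (foxExponents j w).map (fun a => Finsupp.single x 1 + a)

/-- The substitution of the commutative image of the word `g x` for every variable `x`. -/
noncomputable def subst (g : α → List β) : MvPolynomial α ℤ →ₐ[ℤ] MvPolynomial β ℤ :=
  aeval (fun x => mon (g x))

@[simp] lemma mon_nil : mon ([] : List α) = 1 := by simp [mon]

@[simp] lemma mon_cons (x : α) (w : List α) : mon (x :: w) = X x * mon w := by simp [mon]

lemma mon_ne_zero (w : List α) : mon w ≠ 0 := by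
  induction w with
  | nil => simp
  | cons x w ih => simpa using ih

lemma constantCoeff_mon {w : List α} (hw : w ≠ []) : constantCoeff (mon w) = 0 := by
  cases w with
  | nil => exact absurd rfl hw
  | cons x w => simp

@[simp] lemma subst_X (g : α → List β) (x : α) : subst g (X x) = mon (g x) := by
  simp [subst]

/-- The exponent to which `subst g` sends the exponent `a`. -/
noncomputable def pushExponent [DecidableEq β] (g : α → List β) (a : α →₀ ℕ) : β →₀ ℕ :=
  ∑ x ∈ a.support, a x • Multiset.toFinsupp (g x : Multiset β)

lemma mon_eq_monomial [DecidableEq α] (w : List α) :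
    mon w = monomial (Multiset.toFinsupp (w : Multiset α)) 1 := by
  induction w with
  | nil => simp
  | cons x w ih =>
    rw [mon_cons, ih, X, monomial_mul, ← Multiset.cons_coe, ← Multiset.singleton_add, map_add,
      Multiset.toFinsupp_singleton, one_mul]

lemma subst_monomial [DecidableEq β] (g : α → List β) (a : α →₀ ℕ) (r : ℤ) :
    subst g (monomial a r) = monomial (pushExponent g a) r := by
  rw [subst, aeval_monomial, Finsupp.prod]
  have : ∀ x ∈ a.support, mon (g x) ^ a x
      = monomial (a x • Multiset.toFinsupp (g x : Multiset β)) (1 : ℤ) := by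
    intro x _
    rw [mon_eq_monomial, monomial_pow, one_pow]
  rw [Finset.prod_congr rfl this, ← monomial_sum_one, pushExponent, algebraMap_eq, C_mul_monomial,
    mul_one]

lemma pushExponent_apply [DecidableEq β] [Fintype α] (g : α → List β) (a : α →₀ ℕ) (b : β) :
    pushExponent g a b = ∑ x, a x * (g x).count b := by
  rw [pushExponent, Finsupp.finsetSum_apply]
  simp only [Finsupp.smul_apply, Multiset.toFinsupp_apply, Multiset.coe_count, smul_eq_mul]
  refine Finset.sum_subset (Finset.subset_univ _) fun x _ hx => ?_
  rw [Finsupp.notMem_support_iff.1 hx, zero_mul]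

/-- If a polynomial is killed by `subst g`, then each of its monomials is identified with another
one. -/
lemma exists_pushExponent_eq [DecidableEq β] (g : α → List β) {p : MvPolynomial α ℤ}
    (hp : subst g p = 0) {a : α →₀ ℕ} (ha : a ∈ p.support) :
    ∃ b ∈ p.support, b ≠ a ∧ pushExponent g b = pushExponent g a := by
  by_contra! H
  have h1 : subst g p = ∑ b ∈ p.support, monomial (pushExponent g b) (coeff b p) := by
    conv_lhs => rw [p.as_sum]
    rw [map_sum]
    exact Finset.sum_congr rfl fun b _ => subst_monomial g b _
  have h2 : coeff (pushExponent g a) (subst g p) = coeff a p := by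
    rw [h1, coeff_sum, Finset.sum_eq_single a]
    · simp
    · intro b hb hba
      rw [coeff_monomial, if_neg (H b hb hba)]
    · exact fun h => absurd ha h
  rw [hp, coeff_zero] at h2
  exact (mem_support_iff.1 ha) h2.symm

variable [DecidableEq α]

@[simp] lemma fox_nil (j : α) : fox j [] = 0 := rfl

lemma fox_cons (j x : α) (w : List α) :
    fox j (x :: w) = (if x = j then 1 else 0) + X x * fox j w := rfl

lemma fox_append (j : α) (v w : List α) : fox j (v ++ w) = fox j v + mon v * fox j w := by
  induction v with
  | nil => simp
  | cons x v ih => simp [fox_cons, ih]; ring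

/-- The chain rule for Fox derivatives. -/
lemma fox_flatMap [DecidableEq β] [Fintype α] (g : α → List β) (a : β) (w : List α) :
    fox a (w.flatMap g) = ∑ j, subst g (fox j w) * fox a (g j) := by
  induction w with
  | nil => simp
  | cons x w ih =>
    simp only [List.flatMap_cons, fox_append, ih, fox_cons, map_add, map_mul, subst_X, add_mul,
      Finset.sum_add_distrib, Finset.mul_sum, mul_assoc]
    congr 1
    simp [apply_ite]

/-- The fundamental formula of the Fox calculus. -/
lemma sum_fox_mul [Fintype α] (w : List α) : ∑ j, fox j w * (X j - 1) = mon w - 1 := by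
  induction w with
  | nil => simp
  | cons x w ih =>
    have : ∑ j, fox j (x :: w) * (X j - 1)
        = ∑ j, (if x = j then (X j - 1 : MvPolynomial α ℤ) else 0)
          + X x * ∑ j, fox j w * (X j - 1) := by
      rw [Finset.mul_sum, ← Finset.sum_add_distrib]
      refine Finset.sum_congr rfl fun j _ => ?_
      rw [fox_cons]; split_ifs <;> ring
    rw [this, ih, mon_cons]
    simp; ring

lemma eval₂_one_fox (j : α) (w : List α) :
    eval₂Hom (Int.castRingHom ℚ) (fun _ => 1) (fox j w) = (w.count j : ℚ) := by
  induction w with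
  | nil => simp
  | cons x w ih =>
    rw [fox_cons, map_add, map_mul, ih, List.count_cons]
    by_cases h : x = j <;> simp [h, add_comm]

lemma constantCoeff_subst_fox_nonneg (g : α → List β) (j : α) (w : List α) :
    0 ≤ constantCoeff (subst g (fox j w)) := by
  induction w with
  | nil => simp
  | cons x w ih =>
    have h : 0 ≤ constantCoeff (mon (g x)) := by
      by_cases hx : g x = []
      · simp [hx]
      · rw [constantCoeff_mon hx]
    rw [fox_cons]
    simp only [map_add, map_mul, subst_X]
    refine add_nonneg ?_ (mul_nonneg h ih)
    split_ifs <;> simp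

lemma subst_fox_filter (g : α → List β) (S : α → Prop) [DecidablePred S]
    (hS : ∀ x, ¬ S x → g x = []) {j : α} (hj : S j) (w : List α) :
    subst g (fox j (w.filter S)) = subst g (fox j w) := by
  induction w with
  | nil => simp
  | cons x w ih =>
    by_cases hx : S x
    · simp [hx, fox_cons, ih]
    · have : x ≠ j := fun h => hx (h ▸ hj)
      simp [hx, fox_cons, ih, hS x hx, this]

/-- If the letters outside `S` are erased by `g`, and at most one letter of `S` is, then the images
of the Fox derivatives with respect to the letters of `S` determine the word up to the letters
outside `S`: they cannot agree for two words over `S` with different first letters, because the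
constant coefficients tell the first letters apart. -/
lemma filter_eq_of_subst_fox_eq (g : α → List β) (S : α → Prop) [DecidablePred S]
    (hS : ∀ x, ¬ S x → g x = [])
    (hS' : ∀ x y, S x → S y → x ≠ y → g x = [] → g y ≠ []) {u v : List α}
    (huv : ∀ j, S j → subst g (fox j u) = subst g (fox j v)) : u.filter S = v.filter S := by
  have key : ∀ u v : List α, (∀ x ∈ u, S x) → (∀ x ∈ v, S x) →
      (∀ j, S j → subst g (fox j u) = subst g (fox j v)) → u = v := by
    have cons_pos : ∀ (x : α) (w : List α), 0 < constantCoeff (subst g (fox x (x :: w))) := by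
      intro x w
      have h1 := constantCoeff_subst_fox_nonneg g x w
      have h2 : 0 ≤ constantCoeff (mon (g x)) := by
        by_cases hx : g x = []
        · simp [hx]
        · rw [constantCoeff_mon hx]
      have := mul_nonneg h2 h1
      simp only [fox_cons, if_true, map_add, map_mul, map_one, subst_X]
      omega
    have cons_zero : ∀ (x y : α) (w : List α), x ≠ y → g y ≠ [] →
        constantCoeff (subst g (fox x (y :: w))) = 0 := by
      intro x y w hxy hy
      simp [fox_cons, hxy.symm, constantCoeff_mon hy]
    intro u
    induction u with
    | nil =>
      intro v _ hv h
      cases v with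
      | nil => rfl
      | cons y v =>
        have h1 := cons_pos y v
        rw [← h y (hv y (by simp))] at h1
        simp at h1
    | cons x u ih =>
      intro v hu hv h
      cases v with
      | nil =>
        have h1 := cons_pos x u
        rw [h x (hu x (by simp))] at h1
        simp at h1
      | cons y v =>
        have hx := hu x (by simp)
        have hy := hv y (by simp)
        by_cases hxy : x = y
        · subst hxy
          rw [ih v (fun z hz => hu z (by simp [hz])) (fun z hz => hv z (by simp [hz]))]
          intro j hj
          have := h j hj
          simp only [fox_cons, map_add, map_mul, subst_X, add_right_inj] at this
          exact mul_left_cancel₀ (mon_ne_zero _) this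
        · exfalso
          by_cases hgy : g y = []
          · have h1 := cons_pos y v
            rw [← h y hy, cons_zero y x u (Ne.symm hxy) (hS' y x hy hx (Ne.symm hxy) hgy)] at h1
            exact lt_irrefl _ h1
          · have h1 := cons_pos x u
            rw [h x hx, cons_zero x y v hxy hgy] at h1
            exact lt_irrefl _ h1
  refine key _ _ (by simp) (by simp) fun j hj => ?_
  rw [subst_fox_filter g S hS hj, subst_fox_filter g S hS hj, huv j hj]

/-- A word is determined by its Fox derivatives. -/
lemma eq_of_fox_eq {u v : List α} (h : ∀ j, fox j u = fox j v) : u = v := by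
  have := filter_eq_of_subst_fox_eq (fun x : α => [x]) (fun _ => True) (by simp) (by simp)
    (u := u) (v := v) (fun j _ => by rw [h j])
  simpa using this

lemma fox_eq_sum (j : α) (w : List α) :
    fox j w = ((foxExponents j w).map fun a => monomial a (1 : ℤ)).sum := by
  induction w with
  | nil => simp [foxExponents]
  | cons x w ih =>
    have : ∀ l : List (α →₀ ℕ), (X x : MvPolynomial α ℤ) * (l.map fun a => monomial a (1 : ℤ)).sum
        = (l.map fun a => monomial (Finsupp.single x 1 + a) (1 : ℤ)).sum := by
      intro l
      induction l with
      | nil => simp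
      | cons a l ihl =>
        rw [List.map_cons, List.sum_cons, mul_add, ihl, X, monomial_mul, one_mul, List.map_cons,
          List.sum_cons]
    rw [fox_cons, foxExponents, List.map_append, List.sum_append, ih, this, List.map_map]
    congr 1
    split_ifs <;> simp

lemma mem_foxExponents {j : α} {w : List α} {a : α →₀ ℕ} (ha : a ∈ (fox j w).support) :
    a ∈ foxExponents j w := by
  rw [fox_eq_sum] at ha
  generalize foxExponents j w = l at ha ⊢
  induction l with
  | nil => simp at ha
  | cons b l ih =>
    rw [List.map_cons, List.sum_cons] at ha
    rcases Finset.mem_union.1 (support_add ha) with h | h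
    · have := support_monomial_subset h
      simp_all
    · exact List.mem_cons_of_mem _ (ih h)

lemma length_foxExponents (j : α) (w : List α) : (foxExponents j w).length = w.count j := by
  induction w with
  | nil => simp [foxExponents]
  | cons x w ih =>
    rw [foxExponents, List.length_append, List.length_map, ih, List.count_cons]
    by_cases h : x = j <;> simp [h, add_comm]

/-- Prefixes of a word are linearly ordered, so the exponents in a Fox derivative form a chain. -/
lemma foxExponents_chain {j : α} {w : List α} {a b : α →₀ ℕ} (ha : a ∈ foxExponents j w)
    (hb : b ∈ foxExponents j w) : a ≤ b ∨ b ≤ a := by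
  induction w generalizing a b with
  | nil => simp [foxExponents] at ha
  | cons x w ih =>
    rw [foxExponents, List.mem_append, List.mem_map] at ha hb
    have zero : ∀ c : α →₀ ℕ, c ∈ (if x = j then [(0 : α →₀ ℕ)] else []) → c = 0 := by
      intro c hc; split_ifs at hc <;> simp_all
    rcases ha with ha | ⟨a', ha, rfl⟩
    · rw [zero a ha]; exact Or.inl zero_le
    · rcases hb with hb | ⟨b', hb, rfl⟩
      · rw [zero b hb]; exact Or.inr zero_le
      · simpa using ih ha hb

lemma map_erase_foxExponents {i j : α} (hij : j ≠ i) (w : List α) :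
    (foxExponents j w).map (Finsupp.erase i) = foxExponents j (w.filter (fun x => x ≠ i)) := by
  induction w with
  | nil => simp [foxExponents]
  | cons x w ih =>
    by_cases hx : x = i
    · subst hx
      have h : (x :: w).filter (fun y => y ≠ x) = w.filter (fun y => y ≠ x) := by simp
      rw [h, ← ih]
      simp [foxExponents, hij.symm, Function.comp_def, Finsupp.erase_add]
    · have h : (x :: w).filter (fun x => x ≠ i) = x :: w.filter (fun x => x ≠ i) := by simp [hx]
      rw [h, foxExponents, foxExponents, ← ih, List.map_append, List.map_map, List.map_map]
      congr 1
      · split_ifs <;> simp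
      · refine List.map_congr_left fun a _ => ?_
        simp [Finsupp.erase_add, Finsupp.erase_single_ne (Ne.symm hx)]

/-- If two words become equal when the letter `i` is deleted, and also when the letter `j` is, then
corresponding occurrences of any third letter are preceded by prefixes with the same Parikh
vector. -/
lemma fox_eq_of_filter_eq {i j k : α} (hij : i ≠ j) (hki : k ≠ i) (hkj : k ≠ j) {u v : List α}
    (hi : u.filter (fun x => x ≠ i) = v.filter (fun x => x ≠ i))
    (hj : u.filter (fun x => x ≠ j) = v.filter (fun x => x ≠ j)) : fox k u = fox k v := by
  have h1 : (foxExponents k u).map (Finsupp.erase i) = (foxExponents k v).map (Finsupp.erase i) := by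
    rw [map_erase_foxExponents hki, map_erase_foxExponents hki, hi]
  have h2 : (foxExponents k u).map (Finsupp.erase j) = (foxExponents k v).map (Finsupp.erase j) := by
    rw [map_erase_foxExponents hkj, map_erase_foxExponents hkj, hj]
  have h : foxExponents k u = foxExponents k v := by
    have hl : (foxExponents k u).length = (foxExponents k v).length := by
      simpa using congrArg List.length h1
    refine List.ext_getElem hl fun m hm hm' => ?_
    have e1 : Finsupp.erase i (foxExponents k u)[m] = Finsupp.erase i (foxExponents k v)[m] := by
      have := List.getElem_of_eq h1 (i := m) (by simpa using hm)
      simpa using this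
    have e2 : Finsupp.erase j (foxExponents k u)[m] = Finsupp.erase j (foxExponents k v)[m] := by
      have := List.getElem_of_eq h2 (i := m) (by simpa using hm)
      simpa using this
    ext x
    by_cases hx : x = i
    · have := DFunLike.congr_fun e2 x
      rwa [Finsupp.erase_ne (hx ▸ hij), Finsupp.erase_ne (hx ▸ hij)] at this
    · have := DFunLike.congr_fun e1 x
      rwa [Finsupp.erase_ne hx, Finsupp.erase_ne hx] at this
  rw [fox_eq_sum, fox_eq_sum, h]

lemma mon_eq_of_filter_eq {i j : α} (hij : i ≠ j) {u v : List α}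
    (hi : u.filter (fun x => x ≠ i) = v.filter (fun x => x ≠ i))
    (hj : u.filter (fun x => x ≠ j) = v.filter (fun x => x ≠ j)) : mon u = mon v := by
  have hc : ∀ (y x : α) (w : List α), x ≠ y → (w.filter (fun z => z ≠ y)).count x = w.count x :=
    fun y x w hxy => List.count_filter (by simpa using hxy)
  have hp : u.Perm v := by
    rw [List.perm_iff_count]
    intro x
    by_cases hx : x = i
    · have hxj : x ≠ j := hx ▸ hij
      rw [← hc j x u hxj, ← hc j x v hxj, hj]
    · rw [← hc i x u hx, ← hc i x v hx, hi]
  exact (hp.map X).prod_eq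

end Fox

end WordEq

/-! ### Hyperplane arrangements in the positive orthant -/

namespace WordEq

open Filter Topology

section Separation

variable {n : ℕ}

/-- Given finitely many distinct hyperplanes that meet the open positive orthant, there is one more
point than there are hyperplanes in that orthant such that any two of the points are strictly
separated by one of the hyperplanes. In the induction, the new hyperplane splits a cell of the old
arrangement, so that a point on the appropriate side of it can be added. -/
lemma exists_separated_points (T : Finset (Module.Dual ℚ (Fin n → ℚ))) (h0 : ∀ f ∈ T, f ≠ 0)
    (hT : ∀ f ∈ T, ∀ g ∈ T, f ≠ g → ¬ LinearMap.ker f ≤ LinearMap.ker g)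
    (hpos : ∀ f ∈ T, ∃ p : Fin n → ℚ, (∀ j, 0 < p j) ∧ f p = 0) :
    ∃ C : Finset (Fin n → ℚ), C.card = T.card + 1 ∧ (∀ c ∈ C, ∀ j, 0 < c j) ∧
      (∀ c ∈ C, ∀ f ∈ T, f c ≠ 0) ∧ ∀ c ∈ C, ∀ c' ∈ C, c ≠ c' → ∃ f ∈ T, f c * f c' < 0 := by
  classical
  have tend : ∀ a b : ℚ, Tendsto (fun ε : ℚ => a + ε * b) (𝓝[>] 0) (𝓝 a) := by
    intro a b
    have : Continuous fun ε : ℚ => a + ε * b := by fun_prop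
    have h := this.tendsto 0
    simp only [zero_mul, add_zero] at h
    exact h.mono_left nhdsWithin_le_nhds
  have pos : ∀ c d : Fin n → ℚ, (∀ j, 0 < c j) → ∀ᶠ ε : ℚ in 𝓝[>] 0, ∀ j, 0 < (c + ε • d) j := by
    intro c d hc
    rw [eventually_all]
    intro j
    simpa using (tend (c j) (d j)).eventually (lt_mem_nhds (hc j))
  have sign : ∀ (c d : Fin n → ℚ) (f : Module.Dual ℚ (Fin n → ℚ)), f c ≠ 0 →
      ∀ᶠ ε : ℚ in 𝓝[>] 0, 0 < f c * f (c + ε • d) := by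
    intro c d f hf
    have := (tend (f c * f c) (f c * f d)).eventually (lt_mem_nhds (mul_self_pos.2 hf))
    filter_upwards [this] with ε hε
    simpa [mul_add, mul_left_comm] using hε
  have nonzero : ∀ (c d : Fin n → ℚ) (f : Module.Dual ℚ (Fin n → ℚ)), f d ≠ 0 →
      ∀ᶠ ε : ℚ in 𝓝[>] 0, f (c + ε • d) ≠ 0 := by
    intro c d f hd
    by_cases hc : f c = 0
    · filter_upwards [self_mem_nhdsWithin] with ε hε
      simpa [hc, hd] using ne_of_gt hε
    · filter_upwards [sign c d f hc] with ε hε h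
      rw [h, mul_zero] at hε
      exact lt_irrefl _ hε
  induction T using Finset.induction_on with
  | empty => exact ⟨{fun _ => 1}, by simp, by simp, by simp, by simp⟩
  | insert s T hs ih =>
    obtain ⟨C, hcard, hCpos, hCne, hCsep⟩ := ih (fun f hf => h0 f (by simp [hf]))
      (fun f hf g hg => hT f (by simp [hf]) g (by simp [hg])) (fun f hf => hpos f (by simp [hf]))
    have hs0 : s ≠ 0 := h0 s (by simp)
    obtain ⟨d, hd⟩ : ∃ d, s d ≠ 0 := by
      by_contra! H
      exact hs0 (LinearMap.ext H)
    -- Move the old points off the new hyperplane.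
    obtain ⟨ε, hε⟩ : ∃ ε : ℚ, ∀ c ∈ C, (∀ j, 0 < (c + ε • d) j) ∧
        (∀ f ∈ T, 0 < f c * f (c + ε • d)) ∧ s (c + ε • d) ≠ 0 := by
      refine Eventually.exists (f := 𝓝[>] (0 : ℚ)) ?_
      rw [Finset.eventually_all]
      intro c hc
      refine (pos c d (hCpos c hc)).and (Eventually.and ?_ (nonzero c d s hd))
      rw [Finset.eventually_all]
      exact fun f hf => sign c d f (hCne c hc f hf)
    set C₁ := C.image (fun c => c + ε • d) with hC₁
    have hC₁card : C₁.card = T.card + 1 := by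
      rw [hC₁, Finset.card_image_of_injective _ (add_left_injective _), hcard]
    have hC₁pos : ∀ c ∈ C₁, ∀ j, 0 < c j := by
      intro c hc
      obtain ⟨b, hb, rfl⟩ := Finset.mem_image.1 hc
      exact (hε b hb).1
    have hC₁s : ∀ c ∈ C₁, s c ≠ 0 := by
      intro c hc
      obtain ⟨b, hb, rfl⟩ := Finset.mem_image.1 hc
      exact (hε b hb).2.2
    have hC₁ne : ∀ c ∈ C₁, ∀ f ∈ T, f c ≠ 0 := by
      intro c hc f hf h
      obtain ⟨b, hb, rfl⟩ := Finset.mem_image.1 hc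
      have := (hε b hb).2.1 f hf
      rw [h, mul_zero] at this
      exact lt_irrefl _ this
    -- Of two numbers of the same sign, if one differs in sign from `x`, then so does the other.
    have trans : ∀ a b x : ℚ, 0 < a * b → a * x < 0 → b * x < 0 := by
      intro a b x h1 h2
      rcases mul_pos_iff.1 h1 with ⟨ha, hb⟩ | ⟨ha, hb⟩
      · exact mul_neg_of_pos_of_neg hb (neg_of_mul_neg_right h2 ha.le)
      · exact mul_neg_of_neg_of_pos hb (pos_of_mul_neg_right h2 ha.le)
    have hC₁sep : ∀ c ∈ C₁, ∀ c' ∈ C₁, c ≠ c' → ∃ f ∈ T, f c * f c' < 0 := by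
      intro c hc c' hc' hne
      obtain ⟨b, hb, rfl⟩ := Finset.mem_image.1 hc
      obtain ⟨b', hb', rfl⟩ := Finset.mem_image.1 hc'
      obtain ⟨f, hf, hlt⟩ := hCsep b hb b' hb' (fun h => hne (by rw [h]))
      refine ⟨f, hf, ?_⟩
      have h1 := trans _ _ _ ((hε b hb).2.1 f hf) hlt
      rw [mul_comm] at h1 ⊢
      exact trans _ _ _ ((hε b' hb').2.1 f hf) h1
    -- A point of the new hyperplane on none of the old ones, from which to step off on either side.
    obtain ⟨p₀, hp₀, hsp₀⟩ := hpos s (by simp)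
    obtain ⟨e, hse, he⟩ : ∃ e, s e = 0 ∧ ∀ f ∈ T, f e ≠ 0 := by
      by_contra! H
      have := Subspace.biUnion_ne_univ_of_top_notMem (k := ℚ) (E := LinearMap.ker s)
        (s := T.image fun f => LinearMap.ker (f.comp (LinearMap.ker s).subtype)) (by
          rw [Finset.mem_image]
          rintro ⟨f, hf, htop⟩
          refine hT s (by simp) f (by simp [hf]) (fun h => hs (h ▸ hf)) fun x hx => ?_
          have : (⟨x, hx⟩ : LinearMap.ker s) ∈
            LinearMap.ker (f.comp (LinearMap.ker s).subtype) := htop ▸ Submodule.mem_top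
          simpa using this)
      refine this (Set.eq_univ_of_forall fun x => ?_)
      obtain ⟨f, hf, hfx⟩ := H x x.2
      simp only [Set.mem_iUnion]
      exact ⟨_, Finset.mem_image_of_mem _ hf, by simpa using hfx⟩
    obtain ⟨δ, hδ₁, hδ₂⟩ := ((pos p₀ e hp₀).and
      ((Finset.eventually_all T).2 fun f hf => nonzero p₀ e f (he f hf))).exists
    set p := p₀ + δ • e with hp
    have hsp : s p = 0 := by simp [hp, hsp₀, hse]
    have step : ∀ d' : Fin n → ℚ, ∃ η : ℚ, 0 < η ∧ (∀ j, 0 < (p + η • d') j) ∧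
        ∀ f ∈ T, 0 < f p * f (p + η • d') := by
      intro d'
      refine Eventually.exists (f := 𝓝[>] (0 : ℚ)) ?_
      refine (eventually_mem_of_tendsto_nhdsWithin tendsto_id).and ((pos p d' hδ₁).and ?_)
      rw [Finset.eventually_all]
      exact fun f hf => sign p d' f (hδ₂ f hf)
    obtain ⟨q, hqpos, hqT, hqs, hqsep⟩ : ∃ q : Fin n → ℚ, (∀ j, 0 < q j) ∧ (∀ f ∈ T, f q ≠ 0) ∧
        s q ≠ 0 ∧ ∀ c ∈ C₁, ∃ f ∈ insert s T, f q * f c < 0 := by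
      have fin : ∀ d' : Fin n → ℚ, s d' ≠ 0 →
          (∀ c ∈ C₁, (∃ f ∈ T, f p * f c < 0) ∨ s d' * s c < 0) →
          ∃ q : Fin n → ℚ, (∀ j, 0 < q j) ∧ (∀ f ∈ T, f q ≠ 0) ∧
            s q ≠ 0 ∧ ∀ c ∈ C₁, ∃ f ∈ insert s T, f q * f c < 0 := by
        intro d' hd' hsep
        obtain ⟨η, hη, h1, h2⟩ := step d'
        have hsq : s (p + η • d') = η * s d' := by simp [hsp]
        refine ⟨p + η • d', h1, fun f hf h => ?_, ?_, fun c hc => ?_⟩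
        · have := h2 f hf
          rw [h, mul_zero] at this
          exact lt_irrefl _ this
        · rw [hsq]; exact mul_ne_zero hη.ne' hd'
        · rcases hsep c hc with ⟨f, hf, hlt⟩ | hlt
          · exact ⟨f, by simp [hf], trans _ _ _ (h2 f hf) hlt⟩
          · refine ⟨s, by simp, ?_⟩
            rw [hsq, mul_assoc]
            exact mul_neg_of_pos_of_neg hη hlt
      by_cases hex : ∃ b ∈ C₁, ∀ f ∈ T, 0 < f p * f b
      · obtain ⟨b, hb, hbT⟩ := hex
        refine fin (-(s b * s d) • d) ?_ fun c hc => ?_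
        · simpa using ⟨hC₁s b hb, hd⟩
        · by_cases hcb : c = b
          · right
            have h1 : 0 < s b * s b := mul_self_pos.2 (hC₁s b hb)
            have h2 : 0 < s d * s d := mul_self_pos.2 hd
            have h3 := mul_pos h1 h2
            subst hcb
            simp only [map_smul, smul_eq_mul]
            linarith
          · left
            obtain ⟨f, hf, hlt⟩ := hC₁sep b hb c hc (Ne.symm hcb)
            exact ⟨f, hf, trans _ _ _ (by rw [mul_comm]; exact hbT f hf) hlt⟩
      · push Not at hex
        refine fin d hd fun c hc => Or.inl ?_
        obtain ⟨f, hf, hle⟩ := hex c hc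
        exact ⟨f, hf, lt_of_le_of_ne hle (mul_ne_zero (hδ₂ f hf) (hC₁ne c hc f hf))⟩
    have hqC : q ∉ C₁ := by
      intro h
      obtain ⟨f, -, hlt⟩ := hqsep q h
      exact absurd hlt (not_lt.2 (mul_self_nonneg _))
    refine ⟨insert q C₁, ?_, ?_, ?_, ?_⟩
    · rw [Finset.card_insert_of_notMem hqC, Finset.card_insert_of_notMem hs, hC₁card]
    · intro c hc
      rcases Finset.mem_insert.1 hc with rfl | hc
      exacts [hqpos, hC₁pos c hc]
    · intro c hc f hf
      rcases Finset.mem_insert.1 hc with rfl | hc <;> rcases Finset.mem_insert.1 hf with rfl | hf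
      exacts [hqs, hqT f hf, hC₁s c hc, hC₁ne c hc f hf]
    · intro c hc c' hc' hne
      rw [Finset.mem_insert] at hc hc'
      rcases hc with rfl | hc <;> rcases hc' with rfl | hc'
      · exact absurd rfl hne
      · exact hqsep c' hc'
      · obtain ⟨f, hf, hlt⟩ := hqsep c hc
        exact ⟨f, hf, by rwa [mul_comm]⟩
      · obtain ⟨f, hf, hlt⟩ := hC₁sep c hc c' hc' hne
        exact ⟨f, by simp [hf], hlt⟩

/-- Let `p` be a nonzero polynomial and let `T` be a finite set of distinct hyperplanes that meet the
open positive orthant, such that every monomial of `p` has a companion whose exponent differs from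
it by a normal vector. Choose positive weights in different cells of the arrangement: the monomials
of minimal weight are distinct and pairwise incomparable. -/
lemma exists_antichain_support (p : MvPolynomial (Fin n) ℤ) (hp : p ≠ 0)
    (T : Finset (Module.Dual ℚ (Fin n → ℚ))) (h0 : ∀ f ∈ T, f ≠ 0)
    (hT : ∀ f ∈ T, ∀ g ∈ T, f ≠ g → ¬ LinearMap.ker f ≤ LinearMap.ker g)
    (hpos : ∀ f ∈ T, ∃ p : Fin n → ℚ, (∀ j, 0 < p j) ∧ f p = 0)
    (hcomp : ∀ f ∈ T, ∀ a ∈ p.support, ∃ b ∈ p.support, b ≠ a ∧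
      ∀ y, f y = 0 → ∑ j, y j * (b j : ℚ) = ∑ j, y j * (a j : ℚ)) :
    ∃ A ⊆ p.support, A.card = T.card + 1 ∧ ∀ a ∈ A, ∀ b ∈ A, a ≤ b → a = b := by
  classical
  obtain ⟨C, hcard, hCpos, hCne, hCsep⟩ := exists_separated_points T h0 hT hpos
  have hne : p.support.Nonempty := by simpa [Finset.nonempty_iff_ne_empty] using hp
  have hmin : ∀ c : Fin n → ℚ, ∃ a ∈ p.support, ∀ b ∈ p.support,
      ∑ j, c j * (a j : ℚ) ≤ ∑ j, c j * (b j : ℚ) :=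
    fun c => Finset.exists_min_image _ _ hne
  choose w hw hwmin using hmin
  have hinj : Set.InjOn w C := by
    intro c hc c' hc' heq
    by_contra hcc
    obtain ⟨f, hf, hlt⟩ := hCsep c hc c' hc' hcc
    obtain ⟨b, hb, hba, hker⟩ := hcomp f hf (w c) (hw c)
    have h1 := hwmin c b hb
    have h2 := hwmin c' b hb
    rw [← heq] at h2
    let ℓ : Module.Dual ℚ (Fin n → ℚ) :=
      ∑ j, ((b j : ℚ) - (w c j : ℚ)) • LinearMap.proj j
    have hℓ : ∀ y, ℓ y = ∑ j, y j * (b j : ℚ) - ∑ j, y j * (w c j : ℚ) := by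
      intro y
      simp only [ℓ, LinearMap.sum_apply, LinearMap.smul_apply, LinearMap.proj_apply, smul_eq_mul,
        ← Finset.sum_sub_distrib]
      exact Finset.sum_congr rfl fun j _ => by ring
    -- A point of the hyperplane between `c` and `c'`.
    have h3 : ℓ (f c' • c - f c • c') = 0 := by
      rw [hℓ, hker _ (by simp [mul_comm]), sub_self]
    have h1' : 0 ≤ ℓ c := by rw [hℓ]; linarith
    have h2' : 0 ≤ ℓ c' := by rw [hℓ]; linarith
    have h4 : f c' * ℓ c - f c * ℓ c' = 0 := by simpa using h3
    have hc0 : ℓ c = 0 := by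
      rcases mul_neg_iff.1 hlt with ⟨ha, hb⟩ | ⟨ha, hb⟩ <;> nlinarith
    -- So `ℓ` vanishes on the hyperplane and on a point off it.
    have hℓ0 : ∀ y, ℓ y = 0 := by
      intro y
      have h5 : ℓ (f c • y - f y • c) = 0 := by
        rw [hℓ, hker _ (by simp [mul_comm]), sub_self]
      have h6 : f c * ℓ y = 0 := by simpa [hc0] using h5
      exact (mul_eq_zero.1 h6).resolve_left (hCne c hc f hf)
    refine hba (Finsupp.ext fun j => ?_)
    have h7 := hℓ0 (Pi.single j 1)
    rw [hℓ] at h7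
    simp only [Pi.single_apply, ite_mul, one_mul, zero_mul, Finset.sum_ite_eq', Finset.mem_univ,
      if_true] at h7
    exact_mod_cast sub_eq_zero.1 h7
  refine ⟨C.image w, ?_, ?_, ?_⟩
  · intro a ha
    obtain ⟨c, -, rfl⟩ := Finset.mem_image.1 ha
    exact hw c
  · rw [Finset.card_image_of_injOn hinj, hcard]
  · intro a ha b hb hab
    obtain ⟨c, -, rfl⟩ := Finset.mem_image.1 ha
    obtain ⟨c', hc', rfl⟩ := Finset.mem_image.1 hb
    have h1 := hwmin c' _ (hw c)
    by_contra hne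
    obtain ⟨j, hj⟩ : ∃ j, w c j < w c' j := by
      by_contra! H
      exact hne (le_antisymm hab H)
    refine absurd h1 (not_le.2 (Finset.sum_lt_sum (fun i _ => ?_) ⟨j, Finset.mem_univ _, ?_⟩))
    · exact mul_le_mul_of_nonneg_left (by exact_mod_cast hab i) (hCpos c' hc' i).le
    · exact mul_lt_mul_of_pos_left (by exact_mod_cast hj) (hCpos c' hc' j)

end Separation

end WordEq

/-! ### Minors of two equations -/

namespace WordEq

open MvPolynomial

section Solutions

variable {n : ℕ}

/-- The image of an unknown under a morphism, as a list of letters. -/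
def Morphism.img (h : Morphism n) (x : Fin n) : List (Fin h.k) := (h.toHom (FreeMonoid.of x)).toList

/-- The difference of the Fox derivatives of the two sides of an equation. -/
noncomputable def foxDiff (E : Equation n) (j : Fin n) : MvPolynomial (Fin n) ℤ :=
  fox j E.1.toList - fox j E.2.toList

/-- The `2 × 2` minors of the matrix whose rows are the Fox derivatives of two equations. -/
noncomputable def foxMinor (E E' : Equation n) (k l : Fin n) : MvPolynomial (Fin n) ℤ :=
  foxDiff E k * foxDiff E' l - foxDiff E l * foxDiff E' k

lemma Morphism.toList_toHom (h : Morphism n) (w : FreeMonoid (Fin n)) :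
    (h.toHom w).toList = w.toList.flatMap h.img := by
  induction w using FreeMonoid.inductionOn' with
  | one => simp
  | of_mul x w ih => simp [ih, Morphism.img]

lemma Morphism.solves_iff (h : Morphism n) (E : Equation n) :
    h.Solves E ↔ ∀ a, ∑ j, subst h.img (foxDiff E j) * fox a (h.img j) = 0 := by
  have key : ∀ a, ∑ j, subst h.img (foxDiff E j) * fox a (h.img j)
      = fox a (h.toHom E.1).toList - fox a (h.toHom E.2).toList := by
    intro a
    simp only [h.toList_toHom, fox_flatMap, foxDiff, map_sub, sub_mul, Finset.sum_sub_distrib]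
  simp only [key, sub_eq_zero]
  exact ⟨fun H a => by rw [show h.toHom E.1 = h.toHom E.2 from H],
    fun H => FreeMonoid.toList.injective (eq_of_fox_eq H)⟩

lemma Morphism.gamma_apply (h : Morphism n) (i : Fin h.k) (j : Fin n) :
    h.gamma i j = ((h.img j).count i : ℚ) := rfl

/-- If the `j`-th unit vector is not in `Γ_h`, then an element of the kernel of the matrix of Fox
derivatives of the words `h(x)` is determined by its `j`-th coordinate. Indeed `n - 1` rows of the
matrix and the unit vector form a square matrix; at the point `(1, …, 1)` its determinant does not
vanish, as the rows become a basis of `Γ_h` there. -/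
lemma Morphism.eq_zero_of_coord_eq_zero (h : Morphism n) (hr : h.rank + 1 = n) {j : Fin n}
    (hj : Pi.single j 1 ∉ h.Gamma) (q : Fin n → MvPolynomial (Fin h.k) ℤ)
    (hq : ∀ a, ∑ x, q x * fox a (h.img x) = 0) (hqj : q j = 0) : q = 0 := by
  obtain _ | m := n
  · exact j.elim0
  have hm : m = Module.finrank ℚ (Submodule.span ℚ (Set.range h.gamma)) :=
    (Nat.succ_injective hr).symm
  obtain ⟨f, hf, hspan, hli⟩ :=
    Submodule.exists_fun_fin_finrank_span_eq ℚ (Set.range h.gamma)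
  choose a ha using fun i => hf (Fin.cast hm i)
  have hli' : LinearIndependent ℚ
      (Fin.cons (Pi.single j 1) (fun i => f (Fin.cast hm i)) : Fin (m + 1) → Fin (m + 1) → ℚ) := by
    rw [linearIndependent_finCons]
    refine ⟨hli.comp _ (Fin.cast_injective hm), fun hmem => hj ?_⟩
    have hle : Submodule.span ℚ (Set.range fun i => f (Fin.cast hm i)) ≤ h.Gamma := by
      rw [Submodule.span_le]
      rintro _ ⟨i, rfl⟩
      exact Submodule.subset_span (hf _)
    exact hle hmem
  let M : Matrix (Fin (m + 1)) (Fin (m + 1)) (MvPolynomial (Fin h.k) ℤ) :=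
    Matrix.of (Fin.cons (Pi.single j 1) (fun i x => fox (a i) (h.img x)))
  let ev := eval₂Hom (Int.castRingHom ℚ) (fun _ : Fin h.k => 1)
  have hM : (ev.mapMatrix M).row
      = (Fin.cons (Pi.single j 1) (fun i => f (Fin.cast hm i)) :
          Fin (m + 1) → Fin (m + 1) → ℚ) := by
    funext i x
    refine Fin.cases ?_ (fun i => ?_) i
    · simp [M, Pi.single_apply, apply_ite ev]
    · have : ev (fox (a i) (h.img x)) = ((h.img x).count (a i) : ℚ) := eval₂_one_fox _ _
      simp only [M, Matrix.row, RingHom.mapMatrix_apply, Matrix.map_apply, Matrix.of_apply,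
        Fin.cons_succ, this, ← ha, h.gamma_apply]
  have hdet : M.det ≠ 0 := by
    intro h0
    rw [← hM, Matrix.linearIndependent_rows_iff_isUnit, Matrix.isUnit_iff_isUnit_det,
      ← RingHom.map_det, h0, map_zero] at hli'
    exact not_isUnit_zero hli'
  refine Matrix.eq_zero_of_mulVec_eq_zero hdet (funext fun i => ?_)
  refine Fin.cases ?_ (fun i => ?_) i
  · simp [M, Matrix.mulVec, dotProduct, Pi.single_apply, hqj]
  · simp only [M, Matrix.mulVec, dotProduct, Matrix.of_apply, Fin.cons_succ, Pi.zero_apply]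
    rw [← hq (a i)]
    exact Finset.sum_congr rfl fun x _ => mul_comm _ _

lemma Morphism.exists_single_notMem (h : Morphism n) (hr : h.rank + 1 = n) :
    ∃ j, Pi.single j 1 ∉ h.Gamma := by
  by_contra! H
  have htop : h.Gamma = ⊤ := by
    rw [eq_top_iff, ← (Pi.basisFun ℚ (Fin n)).span_eq, Submodule.span_le]
    rintro _ ⟨j, rfl⟩
    simpa using H j
  rw [Morphism.rank, htop, finrank_top, Module.finrank_fin_fun] at hr
  omega

/-- The matrix of Fox derivatives of the words `h(x)` has a kernel of dimension at most one. -/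
lemma Morphism.mul_eq_mul_of_kernel (h : Morphism n) (hr : h.rank + 1 = n)
    {q q' : Fin n → MvPolynomial (Fin h.k) ℤ}
    (hq : ∀ a, ∑ x, q x * fox a (h.img x) = 0) (hq' : ∀ a, ∑ x, q' x * fox a (h.img x) = 0)
    (k l : Fin n) : q k * q' l = q l * q' k := by
  obtain ⟨j, hj⟩ := h.exists_single_notMem hr
  have hprop : ∀ x, q' j * q x = q j * q' x := by
    intro x
    have := h.eq_zero_of_coord_eq_zero hr hj (fun x => q' j * q x - q j * q' x) (fun a => by
      simp only [sub_mul, mul_assoc, Finset.sum_sub_distrib, ← Finset.mul_sum, hq, hq', mul_zero,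
        sub_zero]) (by ring)
    exact sub_eq_zero.1 (congrFun this x)
  by_cases h1 : q j = 0
  · by_cases h2 : q' j = 0
    · rw [h.eq_zero_of_coord_eq_zero hr hj q hq h1]; simp
    · have hx : ∀ x, q x = 0 := fun x => by
        have := hprop x
        rw [h1, zero_mul] at this
        exact (mul_eq_zero.1 this).resolve_left h2
      simp [hx]
  · refine mul_left_cancel₀ h1 ?_
    linear_combination q l * hprop k - q k * hprop l

lemma subst_foxMinor_eq_zero {E E' : Equation n} {h : Morphism n} (hh : h ∈ commonSolutions E E')
    (k l : Fin n) : subst h.img (foxMinor E E' k l) = 0 := by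
  obtain ⟨hE, hE', hr⟩ := hh
  rw [foxMinor, map_sub, map_mul, map_mul, sub_eq_zero]
  exact h.mul_eq_mul_of_kernel hr ((h.solves_iff E).1 hE) ((h.solves_iff E').1 hE') k l

lemma Morphism.apply_eq_zero_of_img_eq_nil (h : Morphism n) {j : Fin n} (hj : h.img j = [])
    {y : Fin n → ℚ} (hy : y ∈ h.Gamma) : y j = 0 := by
  have hle : h.Gamma ≤ LinearMap.ker (LinearMap.proj j : (Fin n → ℚ) →ₗ[ℚ] ℚ) := by
    rw [Morphism.Gamma, Submodule.span_le]
    rintro _ ⟨i, rfl⟩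
    simp [h.gamma_apply, hj]
  simpa using hle hy

lemma Morphism.single_notMem_of_img_eq_nil (h : Morphism n) {j : Fin n} (hj : h.img j = []) :
    Pi.single j 1 ∉ h.Gamma := by
  intro hmem
  simpa using h.apply_eq_zero_of_img_eq_nil hj hmem

/-- A morphism of rank `n - 1` erases at most one unknown. -/
lemma Morphism.eq_of_img_eq_nil (h : Morphism n) (hr : h.rank + 1 = n) {i j : Fin n}
    (hi : h.img i = []) (hj : h.img j = []) : i = j := by
  by_contra hij
  have := h.eq_zero_of_coord_eq_zero hr (h.single_notMem_of_img_eq_nil hj) (Pi.single i 1)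
    (fun a => by simp [Pi.single_apply, hi]) (by simp [Ne.symm hij])
  simpa using congrFun this i

/-- If all minors of two equations vanish, then a solution of rank `n - 1` of the first one, if this
is nontrivial, solves the second one. -/
lemma Morphism.solves_of_foxMinor_eq_zero {E E' : Equation n} (h : Morphism n)
    (hr : h.rank + 1 = n) (hE : h.Solves E) (hne : E.1 ≠ E.2)
    (hmin : ∀ k l, foxMinor E E' k l = 0) : h.Solves E' := by
  obtain ⟨k, hk⟩ : ∃ k, subst h.img (foxDiff E k) ≠ 0 := by
    by_contra! H
    refine hne (FreeMonoid.toList.injective ?_)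
    have := filter_eq_of_subst_fox_eq h.img (fun _ => True) (by simp)
      (fun x y _ _ hxy hx hy => hxy (h.eq_of_img_eq_nil hr hx hy))
      (u := E.1.toList) (v := E.2.toList)
      (fun j _ => by have := H j; rwa [foxDiff, map_sub, sub_eq_zero] at this)
    simpa using this
  rw [h.solves_iff] at hE ⊢
  intro a
  refine (mul_eq_zero.1 ?_).resolve_left hk
  have h1 : ∀ l, subst h.img (foxDiff E k) * subst h.img (foxDiff E' l)
      = subst h.img (foxDiff E' k) * subst h.img (foxDiff E l) := by
    intro l
    have := congrArg (subst h.img) (hmin k l)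
    rw [foxMinor, map_sub, map_mul, map_mul, map_zero, sub_eq_zero] at this
    rw [this, mul_comm]
  rw [Finset.mul_sum]
  simp only [← mul_assoc, h1]
  simp only [mul_assoc, ← Finset.mul_sum, hE a, mul_zero]

lemma exists_foxMinor_ne_zero {E E' : Equation n} (hE : StronglyIndependent ![E, E']) :
    ∃ k l : Fin n, k < l ∧ foxMinor E E' k l ≠ 0 := by
  obtain ⟨g, hg, hgE, hg'⟩ := hE {0} (fun h => by
    have : (1 : Fin 2) ∈ ({0} : Set (Fin 2)) := h ▸ Set.mem_univ _
    simp at this)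
  obtain ⟨g₁, -, hgE₁, hg₁⟩ := hE {1} (fun h => by
    have : (0 : Fin 2) ∈ ({1} : Set (Fin 2)) := h ▸ Set.mem_univ _
    simp at this)
  simp only [Set.mem_singleton_iff, forall_eq, Fin.forall_fin_two, Matrix.cons_val_zero,
    Matrix.cons_val_one] at hgE hg' hgE₁ hg₁
  have hne : E.1 ≠ E.2 := fun h => hg₁ ⟨by rw [Morphism.Solves, h], hgE₁⟩
  obtain ⟨k, l, hkl⟩ : ∃ k l : Fin n, foxMinor E E' k l ≠ 0 := by
    by_contra! H
    exact hg' ⟨hgE, g.solves_of_foxMinor_eq_zero hg hgE hne H⟩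
  rcases lt_trichotomy k l with hlt | rfl | hlt
  · exact ⟨k, l, hlt, hkl⟩
  · exact absurd (sub_self _) hkl
  · refine ⟨l, k, hlt, fun h => hkl ?_⟩
    rw [← neg_eq_zero, ← h, foxMinor, foxMinor]
    ring

/-- An equation with a solution of rank `n - 1` that erases `x_j` becomes trivial when `x_j` is
deleted. -/
lemma Morphism.filter_eq_of_img_eq_nil (h : Morphism n) (hr : h.rank + 1 = n) {E : Equation n}
    (hE : h.Solves E) {j : Fin n} (hj : h.img j = []) :
    E.1.toList.filter (fun x => x ≠ j) = E.2.toList.filter (fun x => x ≠ j) := by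
  refine filter_eq_of_subst_fox_eq h.img (fun x => x ≠ j) (fun x hx => ?_)
    (fun x y hx _ _ hx' => absurd (h.eq_of_img_eq_nil hr hx' hj) hx) (fun x hx => ?_)
  · rw [not_not.1 hx, hj]
  · have := h.eq_zero_of_coord_eq_zero hr (h.single_notMem_of_img_eq_nil hj)
      (fun x => if x = j then 0 else subst h.img (foxDiff E x)) (fun a => ?_) (by simp)
    · have := congrFun this x
      simp only [if_neg hx, foxDiff, map_sub, Pi.zero_apply, sub_eq_zero] at this
      exact this
    · rw [← (h.solves_iff E).1 hE a]
      refine Finset.sum_congr rfl fun x _ => ?_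
      by_cases hx : x = j
      · simp [hx, hj]
      · simp [hx]

/-- If two equations become trivial both when `x_i` is deleted and when `x_j` is, then their minors
vanish: only the Fox derivatives with respect to `x_i` and `x_j` can be nonzero, and the fundamental
formula determines their ratio. -/
lemma foxMinor_eq_zero_of_filter_eq {E E' : Equation n} {i j : Fin n} (hij : i ≠ j)
    (h : ∀ y ∈ ({i, j} : Finset (Fin n)), ∀ F ∈ ({E, E'} : Set (Equation n)),
      F.1.toList.filter (fun x => x ≠ y) = F.2.toList.filter (fun x => x ≠ y))
    (k l : Fin n) : foxMinor E E' k l = 0 := by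
  have hz : ∀ F ∈ ({E, E'} : Set (Equation n)), ∀ x, x ≠ i → x ≠ j → foxDiff F x = 0 := by
    intro F hF x hxi hxj
    rw [foxDiff, fox_eq_of_filter_eq hij hxi hxj (h i (by simp) F hF) (h j (by simp) F hF),
      sub_self]
  have hs : ∀ F ∈ ({E, E'} : Set (Equation n)),
      foxDiff F i * (X i - 1) + foxDiff F j * (X j - 1) = 0 := by
    intro F hF
    have h1 : ∑ x, foxDiff F x * (X x - 1) = 0 := by
      simp only [foxDiff, sub_mul, Finset.sum_sub_distrib, sum_fox_mul]
      rw [mon_eq_of_filter_eq hij (h i (by simp) F hF) (h j (by simp) F hF), sub_self]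
    rw [← h1, ← Finset.sum_pair hij (f := fun x => foxDiff F x * (X x - 1))]
    refine Finset.sum_subset (Finset.subset_univ _) fun x _ hx => ?_
    simp only [Finset.mem_insert, Finset.mem_singleton, not_or] at hx
    rw [hz F hF x hx.1 hx.2, zero_mul]
  have hE := hs E (by simp)
  have hE' := hs E' (by simp)
  have hX : (X i - 1 : MvPolynomial (Fin n) ℤ) ≠ 0 := by
    intro h0
    simpa using congrArg constantCoeff h0
  have hD : foxDiff E i * foxDiff E' j = foxDiff E j * foxDiff E' i := by
    refine mul_right_cancel₀ hX ?_
    linear_combination foxDiff E' j * hE - foxDiff E j * hE'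
  by_cases hk : k ∈ ({i, j} : Finset (Fin n))
  · by_cases hl : l ∈ ({i, j} : Finset (Fin n))
    · simp only [Finset.mem_insert, Finset.mem_singleton] at hk hl
      rcases hk with rfl | rfl <;> rcases hl with rfl | rfl
      · exact sub_self _
      · exact sub_eq_zero.2 hD
      · exact sub_eq_zero.2 hD.symm
      · exact sub_self _
    · simp only [Finset.mem_insert, Finset.mem_singleton, not_or] at hl
      rw [foxMinor, hz E (by simp) l hl.1 hl.2, hz E' (by simp) l hl.1 hl.2]
      simp
  · simp only [Finset.mem_insert, Finset.mem_singleton, not_or] at hk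
    rw [foxMinor, hz E (by simp) k hk.1 hk.2, hz E' (by simp) k hk.1 hk.2]
    simp

end Solutions

end WordEq

/-! ### Counting the hyperplanes -/

namespace WordEq

open MvPolynomial

section Counting

variable {n : ℕ}

/-- A monomial of the minor is a product of a monomial `α` coming from an occurrence of `x_k` or
`x_l` in `E` and of a monomial coming from an occurrence of the other unknown on one side of `E'`.
For fixed `α` and a fixed side, these products form a chain. -/
lemma card_le_of_antichain {E E' : Equation n} {k l : Fin n} {A : Finset (Fin n →₀ ℕ)}
    (hA : A ⊆ (foxMinor E E' k l).support) (hanti : ∀ a ∈ A, ∀ b ∈ A, a ≤ b → a = b) :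
    A.card ≤ 2 * (E.occ k + E.occ l) := by
  classical
  let P : Fin n → Finset (Fin n →₀ ℕ) := fun j =>
    (foxExponents j E.1.toList ++ foxExponents j E.2.toList).toFinset
  have hP : ∀ j, (P j).card ≤ E.occ j := by
    intro j
    refine (List.toFinset_card_le _).trans ?_
    rw [List.length_append, length_foxExponents, length_foxExponents, Equation.occ]
  let side : Bool → List (Fin n) := fun s => if s then E'.1.toList else E'.2.toList
  let other : (Fin n →₀ ℕ) ⊕ (Fin n →₀ ℕ) → Fin n := Sum.elim (fun _ => l) (fun _ => k)
  let L : Finset (((Fin n →₀ ℕ) ⊕ (Fin n →₀ ℕ)) × Bool) :=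
    (P k).disjSum (P l) ×ˢ Finset.univ
  have hL : L.card ≤ 2 * (E.occ k + E.occ l) := by
    rw [Finset.card_product, Finset.card_disjSum, Finset.card_univ, Fintype.card_bool]
    have h1 := hP k
    have h2 := hP l
    omega
  have hsupp : ∀ (F : Equation n) (j : Fin n) (a : Fin n →₀ ℕ), a ∈ (foxDiff F j).support →
      a ∈ foxExponents j F.1.toList ∨ a ∈ foxExponents j F.2.toList := by
    intro F j a ha
    rcases Finset.mem_union.1 (support_sub _ _ _ ha) with h | h
    exacts [Or.inl (mem_foxExponents h), Or.inr (mem_foxExponents h)]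
  have hprod : ∀ (i j : Fin n) (a : Fin n →₀ ℕ), a ∈ (foxDiff E i * foxDiff E' j).support →
      ∃ α ∈ P i, ∃ s, ∃ β ∈ foxExponents j (side s), a = α + β := by
    intro i j a ha
    obtain ⟨α, hα, β, hβ, rfl⟩ := Finset.mem_add.1 (support_mul _ _ ha)
    refine ⟨α, by simpa [P] using hsupp E i α hα, ?_⟩
    rcases hsupp E' j β hβ with h | h
    exacts [⟨true, β, by simpa [side] using h, rfl⟩, ⟨false, β, by simpa [side] using h, rfl⟩]
  have hlab : ∀ a ∈ A, ∃ p ∈ L, ∃ β ∈ foxExponents (other p.1) (side p.2),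
      a = Sum.elim id id p.1 + β := by
    intro a ha
    rcases Finset.mem_union.1 (support_sub _ _ _ (hA ha)) with h | h
    · obtain ⟨α, hα, s, β, hβ, rfl⟩ := hprod k l a h
      exact ⟨(Sum.inl α, s), by simpa [L] using hα, β, hβ, rfl⟩
    · obtain ⟨α, hα, s, β, hβ, rfl⟩ := hprod l k a h
      exact ⟨(Sum.inr α, s), by simpa [L] using hα, β, hβ, rfl⟩
  choose! lab hlabL β hβ hab using hlab
  refine (Finset.card_le_card_of_injOn lab hlabL fun a ha b hb heq => ?_).trans hL
  have hβb := hβ b hb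
  rw [← heq] at hβb
  have hb' := hab b hb
  rw [← heq] at hb'
  rcases foxExponents_chain (hβ a ha) hβb with hle | hle
  · refine hanti a ha b hb ?_
    rw [hab a ha, hb']
    exact add_le_add_right hle _
  · refine (hanti b hb a ha ?_).symm
    rw [hab a ha, hb']
    exact add_le_add_right hle _

/-- Two exponents with the same image have the same pairing with the vectors of `Γ_h`. -/
lemma Morphism.sum_mul_eq_of_pushExponent_eq (h : Morphism n) {a b : Fin n →₀ ℕ}
    (hab : pushExponent h.img b = pushExponent h.img a) {y : Fin n → ℚ} (hy : y ∈ h.Gamma) :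
    ∑ j, y j * (b j : ℚ) = ∑ j, y j * (a j : ℚ) := by
  induction hy using Submodule.span_induction with
  | mem y hy =>
    obtain ⟨i, rfl⟩ := hy
    have h1 := DFunLike.congr_fun hab i
    rw [pushExponent_apply, pushExponent_apply] at h1
    simp only [h.gamma_apply]
    have h2 : ((∑ x, b x * (h.img x).count i : ℕ) : ℚ) = (∑ x, a x * (h.img x).count i : ℕ) := by
      rw [h1]
    push_cast at h2
    simpa only [mul_comm] using h2
  | zero => simp
  | add y z _ _ hy hz => simp only [Pi.add_apply, add_mul, Finset.sum_add_distrib, hy, hz]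
  | smul c y _ hy => simp only [Pi.smul_apply, smul_eq_mul, mul_assoc, ← Finset.mul_sum, hy]

/-- A morphism of rank `n - 1` either erases an unknown or has a positive vector in its subspace. -/
lemma Morphism.exists_pos_mem_Gamma (h : Morphism n) (hne : ∀ j, h.img j ≠ []) :
    ∃ p ∈ h.Gamma, ∀ j, 0 < p j := by
  refine ⟨∑ i, h.gamma i, Submodule.sum_mem _ fun i _ => Submodule.subset_span ⟨i, rfl⟩,
    fun j => ?_⟩
  obtain ⟨i, hi⟩ := List.exists_mem_of_ne_nil _ (hne j)
  rw [Finset.sum_apply]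
  refine Finset.sum_pos' (fun i _ => ?_) ⟨i, Finset.mem_univ _, ?_⟩
  · rw [h.gamma_apply]; positivity
  · rw [h.gamma_apply]
    exact_mod_cast List.count_pos_iff.2 hi

lemma Morphism.exists_ker_eq_Gamma (h : Morphism n) (hr : h.rank + 1 = n) :
    ∃ f : Module.Dual ℚ (Fin n → ℚ), f ≠ 0 ∧ LinearMap.ker f = h.Gamma := by
  obtain ⟨j, hj⟩ := h.exists_single_notMem hr
  obtain ⟨f, hf, hle⟩ := Submodule.exists_le_ker_of_lt_top h.Gamma
    (lt_top_iff_ne_top.2 fun htop => hj (htop ▸ Submodule.mem_top))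
  refine ⟨f, hf, (Submodule.eq_of_le_of_finrank_eq hle ?_).symm⟩
  have h1 := Module.Dual.finrank_ker_add_one_of_ne_zero hf
  rw [Module.finrank_fin_fun] at h1
  rw [Morphism.rank] at hr
  omega

/-- The hyperplanes of the common solutions of rank `n - 1` that erase no unknown. -/
def nonerasingHyperplanes (E E' : Equation n) : Set (Submodule ℚ (Fin n → ℚ)) :=
  {V | ∃ h ∈ commonSolutions E E', (∀ j, h.img j ≠ []) ∧ h.Gamma = V}

/-- The hyperplanes of the common solutions of rank `n - 1` that erase an unknown. -/
def erasingHyperplanes (E E' : Equation n) : Set (Submodule ℚ (Fin n → ℚ)) :=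
  {V | ∃ h ∈ commonSolutions E E', (∃ j, h.img j = []) ∧ h.Gamma = V}

lemma card_nonerasingHyperplanes_lt {E E' : Equation n} {k l : Fin n}
    (hD : foxMinor E E' k l ≠ 0) (T : Finset (Submodule ℚ (Fin n → ℚ)))
    (hT : ∀ V ∈ T, V ∈ nonerasingHyperplanes E E') :
    T.card + 1 ≤ 2 * (E.occ k + E.occ l) := by
  classical
  have : Nonempty (Morphism n) := ⟨⟨0, 1⟩⟩
  choose! h hh hne hV using hT
  have hf : ∀ V ∈ T, ∃ f : Module.Dual ℚ (Fin n → ℚ), f ≠ 0 ∧ LinearMap.ker f = V := by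
    intro V hVT
    obtain ⟨f, hf, hker⟩ := (h V).exists_ker_eq_Gamma (hh V hVT).2.2
    exact ⟨f, hf, hker.trans (hV V hVT)⟩
  choose! f hf0 hfker using hf
  have hinj : Set.InjOn f T := by
    intro V hVT W hWT heq
    rw [← hfker V hVT, ← hfker W hWT, heq]
  have hrank : ∀ V ∈ T, Module.finrank ℚ V + 1 = n := by
    intro V hVT
    have := (hh V hVT).2.2
    rwa [Morphism.rank, hV V hVT] at this
  obtain ⟨A, hA, hcard, hanti⟩ := exists_antichain_support (foxMinor E E' k l) hD (T.image f)
    (by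
      intro g hg
      obtain ⟨V, hVT, rfl⟩ := Finset.mem_image.1 hg
      exact hf0 V hVT)
    (by
      intro g hg g' hg' hgg hle
      obtain ⟨V, hVT, rfl⟩ := Finset.mem_image.1 hg
      obtain ⟨W, hWT, rfl⟩ := Finset.mem_image.1 hg'
      rw [hfker V hVT, hfker W hWT] at hle
      refine hgg (congrArg f (Submodule.eq_of_le_of_finrank_eq hle ?_))
      have h1 := hrank V hVT
      have h2 := hrank W hWT
      omega)
    (by
      intro g hg
      obtain ⟨V, hVT, rfl⟩ := Finset.mem_image.1 hg
      obtain ⟨p, hp, hpos⟩ := (h V).exists_pos_mem_Gamma (hne V hVT)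
      rw [hV V hVT, ← hfker V hVT] at hp
      exact ⟨p, hpos, hp⟩)
    (by
      intro g hg a ha
      obtain ⟨V, hVT, rfl⟩ := Finset.mem_image.1 hg
      obtain ⟨b, hb, hba, hpush⟩ :=
        exists_pushExponent_eq (h V).img (subst_foxMinor_eq_zero (hh V hVT) k l) ha
      refine ⟨b, hb, hba, fun y hy => (h V).sum_mul_eq_of_pushExponent_eq hpush ?_⟩
      rw [hV V hVT, ← hfker V hVT]
      exact hy)
  rw [Finset.card_image_of_injOn hinj] at hcard
  rw [← hcard]
  exact card_le_of_antichain hA hanti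

lemma erasingHyperplanes_subsingleton {E E' : Equation n} {k l : Fin n}
    (hD : foxMinor E E' k l ≠ 0) : (erasingHyperplanes E E').Subsingleton := by
  rintro _ ⟨h, ⟨hE, hE', hr⟩, ⟨i, hi⟩, rfl⟩ _ ⟨h', ⟨hF, hF', hr'⟩, ⟨j, hj⟩, rfl⟩
  have hij : i = j := by
    by_contra hij
    refine hD (foxMinor_eq_zero_of_filter_eq hij (fun y hy F hF => ?_) k l)
    simp only [Finset.mem_insert, Finset.mem_singleton] at hy
    rcases hF with rfl | rfl <;> rcases hy with rfl | rfl
    exacts [h.filter_eq_of_img_eq_nil hr hE hi, h'.filter_eq_of_img_eq_nil hr' hF hj,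
      h.filter_eq_of_img_eq_nil hr hE' hi, h'.filter_eq_of_img_eq_nil hr' hF' hj]
  subst hij
  have key : ∀ g : Morphism n, g.rank + 1 = n → g.img i = [] →
      g.Gamma = LinearMap.ker (LinearMap.proj i : (Fin n → ℚ) →ₗ[ℚ] ℚ) := by
    intro g hg hgi
    refine Submodule.eq_of_le_of_finrank_eq
      (fun y hy => g.apply_eq_zero_of_img_eq_nil hgi hy) ?_
    have h0 : (LinearMap.proj i : Module.Dual ℚ (Fin n → ℚ)) ≠ 0 := by
      intro h0
      simpa using LinearMap.congr_fun h0 (Pi.single i 1)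
    have h1 := Module.Dual.finrank_ker_add_one_of_ne_zero h0
    rw [Module.finrank_fin_fun] at h1
    rw [Morphism.rank] at hg
    omega
  rw [key h hr hi, key h' hr' hj]

lemma numSolutions_le {E E' : Equation n} {k l : Fin n} (hD : foxMinor E E' k l ≠ 0) :
    numSolutions E E' ≤ ((2 * (E.occ k + E.occ l) : ℕ) : ℕ∞) := by
  have hnum : numSolutions E E' = (Morphism.Gamma '' commonSolutions E E').encard := by
    let Γ : Quotient (Morphism.linEquiv n) → Submodule ℚ (Fin n → ℚ) :=
      Quotient.lift Morphism.Gamma fun _ _ => id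
    have hΓ : Function.Injective Γ := by
      intro x y
      induction x using Quotient.inductionOn
      induction y using Quotient.inductionOn
      exact fun hxy => Quotient.sound hxy
    rw [numSolutions, ← hΓ.encard_image, Set.image_image]
    rfl
  have hunion : Morphism.Gamma '' commonSolutions E E'
      ⊆ nonerasingHyperplanes E E' ∪ erasingHyperplanes E E' := by
    rintro _ ⟨h, hh, rfl⟩
    by_cases hj : ∃ j, h.img j = []
    · exact Or.inr ⟨h, hh, hj, rfl⟩
    · exact Or.inl ⟨h, hh, not_exists.1 hj, rfl⟩
  have herase : (erasingHyperplanes E E').encard ≤ 1 :=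
    Set.encard_le_one_iff.2 fun _ _ ha hb => erasingHyperplanes_subsingleton hD ha hb
  have hnonerase : (nonerasingHyperplanes E E').encard + 1 ≤
      ((2 * (E.occ k + E.occ l) : ℕ) : ℕ∞) := by
    by_contra! hlt
    have hle : ((2 * (E.occ k + E.occ l) : ℕ) : ℕ∞) ≤ (nonerasingHyperplanes E E').encard :=
      Order.le_of_lt_add_one hlt
    obtain ⟨t, ht, htcard⟩ := Set.exists_subset_encard_eq hle
    have hfin : t.Finite := Set.finite_of_encard_eq_coe htcard
    have h1 := card_nonerasingHyperplanes_lt hD hfin.toFinset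
      (fun V hV => ht (hfin.mem_toFinset.1 hV))
    rw [hfin.encard_eq_coe_toFinset_card, Nat.cast_inj] at htcard
    omega
  calc numSolutions E E'
      ≤ (nonerasingHyperplanes E E' ∪ erasingHyperplanes E E').encard :=
        hnum ▸ Set.encard_le_encard hunion
    _ ≤ (nonerasingHyperplanes E E').encard + (erasingHyperplanes E E').encard :=
        Set.encard_union_le _ _
    _ ≤ (nonerasingHyperplanes E E').encard + 1 := by gcongr
    _ ≤ _ := hnonerase

lemma numSolutions_comm (E E' : Equation n) : numSolutions E E' = numSolutions E' E := by
  have : commonSolutions E E' = commonSolutions E' E := by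
    ext h
    exact and_left_comm
  rw [numSolutions, numSolutions, this]

lemma Equation.occ_add_occ_le_length (E : Equation n) {k l : Fin n} (hkl : k ≠ l) :
    E.occ k + E.occ l ≤ E.length := by
  have key : ∀ w : List (Fin n), w.count k + w.count l ≤ w.length := by
    intro w
    induction w with
    | nil => simp
    | cons x w ih =>
      rw [List.count_cons, List.count_cons, List.length_cons]
      by_cases hk : x = k
      · subst hk
        simp [hkl]
        omega
      · simp only [beq_iff_eq, hk, if_false]
        split_ifs <;> omega
  have h1 := key E.1.toList
  have h2 := key E.2.toList
  rw [Equation.occ, Equation.occ, Equation.length, FreeMonoid.length, FreeMonoid.length]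
  omega

end Counting

end WordEq

theorem mainTheorem1 (n : ℕ) (E E' : WordEq.Equation n)
    (hE : WordEq.StronglyIndependent ![E, E']) :
    WordEq.numSolutions E E' ≤ ((E.length + E'.length : ℕ) : ℕ∞) ∧
      ∃ k l : Fin n, k < l ∧
        WordEq.numSolutions E E' ≤ ((2 * (E.occ k + E.occ l) : ℕ) : ℕ∞) := by
  obtain ⟨k, l, hkl, hD⟩ := WordEq.exists_foxMinor_ne_zero hE
  have h1 := WordEq.numSolutions_le hD
  -- The minors are antisymmetric in the two equations, so the same `k` and `l` serve for `E'`.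
  have h2 : WordEq.numSolutions E E' ≤ ((2 * (E'.occ k + E'.occ l) : ℕ) : ℕ∞) := by
    rw [WordEq.numSolutions_comm]
    refine WordEq.numSolutions_le fun h0 => hD ?_
    rw [← neg_eq_zero, ← h0, WordEq.foxMinor, WordEq.foxMinor]
    ring
  refine ⟨?_, k, l, hkl, h1⟩
  have h3 := E.occ_add_occ_le_length hkl.ne
  have h4 := E'.occ_add_occ_le_length hkl.ne
  rcases le_total (E.occ k + E.occ l) (E'.occ k + E'.occ l) with h | h
  · exact h1.trans (by exact_mod_cast (by omega))
  · exact h2.trans (by exact_mod_cast (by omega))
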